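/- Let $k$ be a field and $A$ a finite dimensional self-injective $k$-algebra. Assume that $A$ is split (the endomorphism ring of every simple $A$-module is $k$) and that no simple $A$-module is projective. All modules are finitely generated left modules. A map of $A$-modules is called projective if it factors through a projective module, and $\operatorname{Hom}_{A\text{-stab}}(M,N)$ denotes the quotient of $\operatorname{Hom}_A(M,N)$ by the subspace of projective maps. Let $\mathcal S$ be a finite set of indecomposable $A$-modules such that, for $S,T\in\mathcal S$, one has $\operatorname{Hom}_{A\text{-stab}}(S,S)\simeq k$, and $\operatorname{Hom}_{A\text{-stab}}(S,T)=0$ if $S\neq T$. Let $\operatorname{add}(\mathcal S)$ be the class of modules isomorphic to finite direct sums of members of $\mathcal S$. A module $M$ is filtrable if it has a filtration $0=M_r\subseteq M_{r-1}\subseteq\cdots\subseteq M_0=M$ with $M_{i-1}/M_i\in\operatorname{add}(\mathcal S)$ for $1\le i\le r$. A filtrable module $M$ has no projective remainder if there is no decomposition $M=N\oplus P$ with $P\neq 0$ projective and $N$ filtrable. An $\mathcal S$-radical filtration of length $r$ of a filtrable module $M$ is a strictly decreasing filtration $0=M_r\subsetneq M_{r-1}\subsetneq\cdots\subsetneq M_0=M$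 such that, for $1\le i\le r$, the submodule $M_i$ is minimal (for inclusion) among the filtrable submodules $L$ of $M_{i-1}$ with $M_{i-1}/L\in\operatorname{add}(\mathcal S)$. Let $M$ be a filtrable module with no projective remainder, and let $0=M_r\subsetneq\cdots\subsetneq M_0=M$ and $0=M'_{r'}\subsetneq\cdots\subsetneq M'_0=M$ be two $\mathcal S$-radical filtrations of $M$. Then $r=r'$, and there is an automorphism $\sigma$ of $M$ such that $\sigma-\operatorname{id}_M$ is projective and $\sigma(M'_i)=M_i$ for all $0\le i\le r$. -/

import Mathlib

namespace StableFiltration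

/-- A module is indecomposable if it is nonzero and is not the internal direct sum of two
nonzero submodules. -/
def IsIndecomposable (A : Type*) [Ring A] (M : Type*) [AddCommGroup M] [Module A M] : Prop :=
  Nontrivial M ∧ ∀ N P : Submodule A M, IsCompl N P → N = ⊥ ∨ P = ⊥

/-- An algebra `A` is split if the endomorphism ring of every simple `A`-module is `k`. Every
simple module is isomorphic to one in the universe of `A`. -/
def IsSplit.{w, u} (k : Type w) (A : Type u) [Field k] [Ring A] [Algebra k A] : Prop :=
  ∀ (V : Type u) [AddCommGroup V] [Module k V] [Module A V] [IsScalarTower k A V]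
    [IsSimpleModule A V], Function.Bijective (algebraMap k (Module.End A V))

/-- No simple `A`-module is projective. -/
def NoProjectiveSimple.{u} (A : Type u) [Ring A] : Prop :=
  ∀ (V : Type u) [AddCommGroup V] [Module A V] [IsSimpleModule A V], ¬ Module.Projective A V

/-- A module map is projective if it factors through a finitely generated projective module.
Every such module is isomorphic to one in the universe of `A`. -/
def IsProjectiveMap.{u, v, v'} {A : Type u} [Ring A] {M : Type v} {N : Type v'}
    [AddCommGroup M] [Module A M] [AddCommGroup N] [Module A N] (f : M →ₗ[A] N) : Prop :=
  ∃ (P : Type u) (_ : AddCommGroup P) (_ : Module A P),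
    Module.Finite A P ∧ Module.Projective A P ∧
      ∃ (g : M →ₗ[A] P) (h : P →ₗ[A] N), f = h ∘ₗ g

/-- The `k`-subspace of projective maps inside `Hom_A(M, N)`. -/
def projectiveMaps (k A : Type*) [Field k] [Ring A] [Algebra k A] (M N : Type*)
    [AddCommGroup M] [Module A M]
    [AddCommGroup N] [Module k N] [Module A N] [IsScalarTower k A N] :
    Submodule k (M →ₗ[A] N) where
  carrier := {f | IsProjectiveMap f}
  zero_mem' := ⟨PUnit, inferInstance, inferInstance, inferInstance, inferInstance, 0, 0, by simp⟩
  add_mem' := by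
    rintro _ _ ⟨P, _, _, _, _, g, h, rfl⟩ ⟨P', _, _, _, _, g', h', rfl⟩
    exact ⟨P × P', inferInstance, inferInstance, inferInstance, inferInstance,
      g.prod g', h.coprod h', by ext; simp⟩
  smul_mem' := by
    rintro c _ ⟨P, _, _, _, _, g, h, rfl⟩
    exact ⟨P, inferInstance, inferInstance, inferInstance, inferInstance, g, c • h, by ext; simp⟩

/-- The space of morphisms from `M` to `N` in the stable category: module maps modulo
projective maps. -/
abbrev StableHom (k A : Type*) [Field k] [Ring A] [Algebra k A] (M N : Type*)
    [AddCommGroup M] [Module A M]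
    [AddCommGroup N] [Module k N] [Module A N] [IsScalarTower k A N] :=
  (M →ₗ[A] N) ⧸ projectiveMaps k A M N

/-- The conditions on the family `S`: finitely generated indecomposable modules, with
`Hom(S i, S i) = k` and `Hom(S i, S j) = 0` for `i ≠ j` in the stable category. -/
structure IsStablyOrthogonal (k A : Type*) [Field k] [Ring A] [Algebra k A] {ι : Type*}
    (S : ι → Type*) [∀ i, AddCommGroup (S i)] [∀ i, Module k (S i)] [∀ i, Module A (S i)]
    [∀ i, IsScalarTower k A (S i)] : Prop where
  finite : ∀ i, Module.Finite A (S i)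
  indecomposable : ∀ i, IsIndecomposable A (S i)
  hom_self : ∀ i, Nonempty (StableHom k A (S i) (S i) ≃ₗ[k] k)
  hom_ne : ∀ i j, i ≠ j → Subsingleton (StableHom k A (S i) (S j))

section Filtrations

variable (A : Type*) [Ring A] {ι : Type*} (S : ι → Type*) [∀ i, AddCommGroup (S i)]
  [∀ i, Module A (S i)]

/-- `X` lies in `add S`: it is isomorphic to a finite direct sum of members of `S`. -/
def IsInAdd (X : Type*) [AddCommGroup X] [Module A X] : Prop :=
  ∃ (n : ℕ) (c : Fin n → ι), Nonempty (X ≃ₗ[A] ((j : Fin n) → S (c j)))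

/-- `0 = F r ⊆ ⋯ ⊆ F 1 ⊆ F 0 = M` is an `S`-filtration. The values `F i` with `i > r` are
irrelevant. -/
def IsSFiltration {M : Type*} [AddCommGroup M] [Module A M] (r : ℕ) (F : ℕ → Submodule A M) :
    Prop :=
  F 0 = ⊤ ∧ F r = ⊥ ∧
    ∀ i < r, F (i + 1) ≤ F i ∧ IsInAdd A S (F i ⧸ (F (i + 1)).submoduleOf (F i))

/-- `M` is filtrable: it has an `S`-filtration. -/
def IsFiltrable (M : Type*) [AddCommGroup M] [Module A M] : Prop :=
  ∃ (r : ℕ) (F : ℕ → Submodule A M), IsSFiltration A S r F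

/-- `M` has no decomposition `M = N ⊕ P` with `N` filtrable and `P` nonzero projective. -/
def HasNoProjectiveRemainder (M : Type*) [AddCommGroup M] [Module A M] : Prop :=
  ¬ ∃ N P : Submodule A M, IsCompl N P ∧ P ≠ ⊥ ∧ Module.Projective A P ∧ IsFiltrable A S N

/-- `N` is minimal among the filtrable submodules of `M` whose quotient lies in `add S`. -/
def IsMinimalFiltrable {M : Type*} [AddCommGroup M] [Module A M] (N : Submodule A M) : Prop :=
  Minimal (fun L : Submodule A M => IsFiltrable A S L ∧ IsInAdd A S (M ⧸ L)) N

/-- `0 = F r ⊂ ⋯ ⊂ F 1 ⊂ F 0 = M` is an `S`-radical filtration of length `r`: each `F (i + 1)`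
is minimal among the filtrable submodules of `F i` with quotient in `add S`. The inclusions are
strict, so that the zero term is not repeated. The values `F i` with `i > r` are irrelevant. -/
def IsRadicalFiltration {M : Type*} [AddCommGroup M] [Module A M] (r : ℕ)
    (F : ℕ → Submodule A M) : Prop :=
  F 0 = ⊤ ∧ F r = ⊥ ∧
    ∀ i < r, F (i + 1) < F i ∧ IsMinimalFiltrable A S ((F (i + 1)).submoduleOf (F i))

end Filtrations

end StableFiltration

/-! Everything is decided in the stable category. Over a self-injective algebra finitely generated
projectives are injective, so projective maps lift along surjections and extend along injections,
and maps can be corrected by projective maps one layer at a time.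

The central fact is that a minimal filtrable `L` with `X = M ⧸ L` in `add S` gives a stably
universal quotient: every map from `M` to a member of `S` factors through `q : M → X`, uniquely up
to projective maps (`IsMinimalFiltrable.isStablyUniversal`). If a map did not factor, it would be
non-projective on `L`. By `IsFiltered.exists_surjective_of_not_isProjectiveMap` a projective
correction makes it surjective on `L` with filtrable kernel, contradicting minimality. If uniqueness
failed, some surjection onto a member of `S` with filtered kernel would be projective. Then
`exists_projective_submodule` produces a nonzero projective submodule with filtered quotient; it is
injective, so it splits off as a projective remainder.

Hence a stable isomorphism `f : M → M'` induces a stable isomorphism of the top quotients. By the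
hypotheses on stable homs, this is stably a matrix of scalars and so stably equal to an honest
isomorphism `φ`. After a projective correction `f` covers `φ` strictly, and its restriction to
kernels is again a stable isomorphism (`IsStableIso.restrict_ker`). Induction on the length makes
that restriction an isomorphism respecting the filtrations, and `exists_linearEquiv_extension`
extends it to the whole module. The theorem is the case `f = id`; two modules and an arbitrary `f`
are needed because the kernels compared in the induction are different submodules. -/

namespace StableFiltration

/-! ### Projective maps: lifting, extension, and factorization through quotients -/

section ProjectiveMaps

universe u v₁ v₂ v₃ v₄

variable {A : Type u} [Ring A] {M : Type v₁} {N : Type v₂} {X : Type v₃} {Y : Type v₄}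
  [AddCommGroup M] [Module A M] [AddCommGroup N] [Module A N]
  [AddCommGroup X] [Module A X] [AddCommGroup Y] [Module A Y]

namespace IsProjectiveMap

theorem zero : IsProjectiveMap (0 : M →ₗ[A] N) :=
  ⟨PUnit, inferInstance, inferInstance, inferInstance, inferInstance, 0, 0, by simp⟩

theorem comp_left {f : M →ₗ[A] N} (hf : IsProjectiveMap f) (h : N →ₗ[A] X) :
    IsProjectiveMap (h ∘ₗ f) := by
  obtain ⟨P, _, _, _, _, a, b, rfl⟩ := hf
  exact ⟨P, inferInstance, inferInstance, inferInstance, inferInstance, a, h ∘ₗ b, rfl⟩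

theorem comp_right {f : M →ₗ[A] N} (hf : IsProjectiveMap f) (h : X →ₗ[A] M) :
    IsProjectiveMap (f ∘ₗ h) := by
  obtain ⟨P, _, _, _, _, a, b, rfl⟩ := hf
  exact ⟨P, inferInstance, inferInstance, inferInstance, inferInstance, a ∘ₗ h, b, rfl⟩

theorem add {f g : M →ₗ[A] N} (hf : IsProjectiveMap f) (hg : IsProjectiveMap g) :
    IsProjectiveMap (f + g) := by
  obtain ⟨P, _, _, _, _, a, b, rfl⟩ := hf
  obtain ⟨P', _, _, _, _, a', b', rfl⟩ := hg
  exact ⟨P × P', inferInstance, inferInstance, inferInstance, inferInstance,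
    a.prod a', b.coprod b', by ext; simp⟩

theorem neg {f : M →ₗ[A] N} (hf : IsProjectiveMap f) : IsProjectiveMap (-f) := by
  simpa using hf.comp_left (-LinearMap.id)

theorem sum {α : Type*} (s : Finset α) {f : α → M →ₗ[A] N}
    (hf : ∀ a ∈ s, IsProjectiveMap (f a)) : IsProjectiveMap (∑ a ∈ s, f a) :=
  Finset.sum_induction f IsProjectiveMap (fun _ _ => add) zero hf

theorem pi {α : Type*} [Finite α] {Z : α → Type*} [∀ a, AddCommGroup (Z a)]
    [∀ a, Module A (Z a)] {f : M →ₗ[A] ((a : α) → Z a)}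
    (hf : ∀ a, IsProjectiveMap (LinearMap.proj a ∘ₗ f)) : IsProjectiveMap f := by
  classical
  have := Fintype.ofFinite α
  have h : f = ∑ a, LinearMap.single A Z a ∘ₗ (LinearMap.proj a ∘ₗ f) := by
    ext x b
    simp [LinearMap.sum_apply, Finset.sum_apply]
  rw [h]
  exact sum _ fun a _ => (hf a).comp_left _

theorem of_subsingleton_left [Subsingleton M] (f : M →ₗ[A] N) : IsProjectiveMap f := by
  rw [Subsingleton.elim f 0]
  exact zero

theorem module_projective (h : IsProjectiveMap (LinearMap.id : M →ₗ[A] M)) :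
    Module.Projective A M := by
  obtain ⟨P, _, _, _, _, a, b, hab⟩ := h
  exact Module.Projective.of_split a b hab.symm

/-- Projective maps lift along surjections. -/
theorem exists_lift {p : M →ₗ[A] X} (hp : IsProjectiveMap p) {q : N →ₗ[A] X}
    (hq : Function.Surjective q) : ∃ p' : M →ₗ[A] N, IsProjectiveMap p' ∧ q ∘ₗ p' = p := by
  obtain ⟨P, _, _, _, _, a, b, rfl⟩ := hp
  obtain ⟨b', rfl⟩ := Module.projective_lifting_property q b hq
  exact ⟨b' ∘ₗ a, ⟨P, inferInstance, inferInstance, inferInstance, inferInstance, a, b', rfl⟩, rfl⟩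

end IsProjectiveMap

/-- Finitely generated projective modules over a self-injective ring are injective. -/
theorem exists_extension_of_projective (hinj : Module.Injective A A) [Module.Finite A X]
    [Module.Projective A X] {i : M →ₗ[A] N} (hi : Function.Injective i) (f : M →ₗ[A] X) :
    ∃ g : N →ₗ[A] X, g ∘ₗ i = f := by
  -- `X` is a retract of `A ^ n`, so it suffices to extend each coordinate, which is a map to the
  -- injective module `A`.
  obtain ⟨n, a, b, -, -, hab⟩ := Module.Finite.exists_comp_eq_id_of_projective A X
  have hB := Module.Baer.of_injective hinj
  choose g hg using fun j => hB.extension_property i hi (LinearMap.proj j ∘ₗ b ∘ₗ f)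
  refine ⟨a ∘ₗ LinearMap.pi g, ?_⟩
  have h : LinearMap.pi g ∘ₗ i = b ∘ₗ f := by
    ext x j
    exact LinearMap.congr_fun (hg j) x
  rw [LinearMap.comp_assoc, h, ← LinearMap.comp_assoc, hab, LinearMap.id_comp]

/-- Over a self-injective ring, projective maps extend along injections. -/
theorem IsProjectiveMap.exists_extension (hinj : Module.Injective A A) {p : M →ₗ[A] X}
    (hp : IsProjectiveMap p) {i : M →ₗ[A] N} (hi : Function.Injective i) :
    ∃ p' : N →ₗ[A] X, IsProjectiveMap p' ∧ p' ∘ₗ i = p := by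
  obtain ⟨P, _, _, _, _, a, b, rfl⟩ := hp
  obtain ⟨a', rfl⟩ := exists_extension_of_projective hinj hi a
  exact ⟨b ∘ₗ a', ⟨P, inferInstance, inferInstance, inferInstance, inferInstance, a', b, rfl⟩, rfl⟩

/-- A map that vanishes on the kernel of a surjection factors through it. -/
theorem exists_factor_of_ker_le {q : M →ₗ[A] X} (hq : Function.Surjective q) (h : M →ₗ[A] N)
    (hk : LinearMap.ker q ≤ LinearMap.ker h) : ∃ g : X →ₗ[A] N, g ∘ₗ q = h := by
  refine ⟨(LinearMap.ker q).liftQ h hk ∘ₗ (q.quotKerEquivOfSurjective hq).symm, ?_⟩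
  ext x
  have : (q.quotKerEquivOfSurjective hq).symm (q x) = Submodule.Quotient.mk x := by
    rw [LinearEquiv.symm_apply_eq]
    rfl
  simp [this]

/-- Left exactness of stable homs: a map that is projective on the kernel of a surjection
factors through the surjection up to a projective map. -/
theorem exists_factor_of_isProjectiveMap_restrict (hinj : Module.Injective A A)
    {q : M →ₗ[A] X} (hq : Function.Surjective q) (h : M →ₗ[A] N)
    (hp : IsProjectiveMap (h ∘ₗ (LinearMap.ker q).subtype)) :
    ∃ g : X →ₗ[A] N, IsProjectiveMap (h - g ∘ₗ q) := by
  -- Subtracting a projective extension `p` of the restriction of `h` leaves a map that vanishes on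
  -- `ker q`.
  obtain ⟨p, hp, hpe⟩ := hp.exists_extension hinj (LinearMap.ker q).injective_subtype
  obtain ⟨g, hg⟩ := exists_factor_of_ker_le hq (h - p) fun x hx => by
    have := LinearMap.congr_fun hpe ⟨x, hx⟩
    simp at this
    simp [this]
  exact ⟨g, by rw [hg]; simpa using hp⟩

end ProjectiveMaps

/-! ### Maps between members of `S` are scalar modulo projective maps -/

section Scalar

universe u

variable (k : Type*) {A : Type u} [Field k] [Ring A] [Algebra k A] {ι : Type*}
  {S : ι → Type*} [∀ i, AddCommGroup (S i)] [∀ i, Module k (S i)] [∀ i, Module A (S i)]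
  [∀ i, IsScalarTower k A (S i)]

/-- The maps between members of `S` that are zero or a multiple of an identity. -/
inductive IsScalarMap : ∀ {i j : ι}, (S i →ₗ[A] S j) → Prop
  | zero (i j : ι) : IsScalarMap (0 : S i →ₗ[A] S j)
  | smul_id (c : k) (i : ι) : IsScalarMap (c • LinearMap.id : S i →ₗ[A] S i)

namespace IsScalarMap

variable {k} {i j l : ι}

theorem add {f g : S i →ₗ[A] S j} (hf : IsScalarMap k f) (hg : IsScalarMap k g) :
    IsScalarMap k (f + g) := by
  cases hf with
  | zero => simpa using hg
  | smul_id c =>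
    generalize hh : g = g' at hg
    cases hg with
    | zero => simpa using IsScalarMap.smul_id c _
    | smul_id d => simpa [add_smul] using IsScalarMap.smul_id (A := A) (S := S) (c + d) i

theorem sum {α : Type*} (s : Finset α) {f : α → S i →ₗ[A] S j}
    (hf : ∀ a ∈ s, IsScalarMap k (f a)) : IsScalarMap k (∑ a ∈ s, f a) :=
  Finset.sum_induction f (IsScalarMap k) (fun _ _ => add) (zero i j) hf

theorem comp {f : S i →ₗ[A] S j} {g : S l →ₗ[A] S i} (hf : IsScalarMap k f)
    (hg : IsScalarMap k g) : IsScalarMap k (f ∘ₗ g) := by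
  cases hf with
  | zero => simpa using IsScalarMap.zero _ _
  | smul_id c =>
    cases hg with
    | zero => simpa using IsScalarMap.zero _ _
    | smul_id d =>
      have := IsScalarMap.smul_id (A := A) (S := S) (c * d) i
      convert this using 1
      ext x
      simp [mul_smul]

theorem neg {f : S i →ₗ[A] S j} (hf : IsScalarMap k f) : IsScalarMap k (-f) := by
  cases hf with
  | zero => simpa using IsScalarMap.zero _ _
  | smul_id c => simpa using IsScalarMap.smul_id (A := A) (S := S) (-c) i

end IsScalarMap

variable {k}

theorem mem_projectiveMaps {M : Type*} [AddCommGroup M] [Module A M] {i : ι}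
    {f : M →ₗ[A] S i} : f ∈ projectiveMaps k A M (S i) ↔ IsProjectiveMap f := Iff.rfl

namespace IsStablyOrthogonal

variable (hS : IsStablyOrthogonal k A S)
include hS

/-- Otherwise every endomorphism of `S i` is projective and its stable endomorphism space, which is
`k`, vanishes. -/
theorem not_isProjectiveMap_id (i : ι) :
    ¬ IsProjectiveMap (LinearMap.id : S i →ₗ[A] S i) := by
  intro h
  obtain ⟨e⟩ := hS.hom_self i
  have : Subsingleton (StableHom k A (S i) (S i)) := by
    rw [Submodule.Quotient.subsingleton_iff, eq_top_iff]
    intro f _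
    simpa [mem_projectiveMaps] using h.comp_left f
  exact not_subsingleton k e.symm.injective.subsingleton

/-- The class of the identity is nonzero in a one-dimensional space, hence spans it; between
distinct members the stable hom is zero. -/
theorem exists_isScalarMap {i j : ι} (g : S i →ₗ[A] S j) :
    ∃ g₀ : S i →ₗ[A] S j, IsScalarMap k g₀ ∧ IsProjectiveMap (g - g₀) := by
  by_cases hij : i = j
  · subst hij
    obtain ⟨e⟩ := hS.hom_self i
    have h1 : Module.finrank k (StableHom k A (S i) (S i)) = 1 := by
      rw [e.finrank_eq, Module.finrank_self]
    obtain ⟨c, hc⟩ := exists_smul_eq_of_finrank_eq_one h1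
      (x := (projectiveMaps k A (S i) (S i)).mkQ LinearMap.id)
      (by simpa [mem_projectiveMaps] using hS.not_isProjectiveMap_id i)
      ((projectiveMaps k A (S i) (S i)).mkQ g)
    refine ⟨c • LinearMap.id, .smul_id c i, ?_⟩
    rw [← map_smul, eq_comm, ← sub_eq_zero, ← map_sub] at hc
    exact (Submodule.Quotient.mk_eq_zero _).1 hc
  · have := hS.hom_ne i j hij
    rw [Submodule.Quotient.subsingleton_iff] at this
    exact ⟨0, .zero i j, by rw [sub_zero, ← mem_projectiveMaps (k := k), this]; trivial⟩

theorem eq_zero_of_isScalarMap {i j : ι} {g : S i →ₗ[A] S j} (hg : IsScalarMap k g)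
    (hp : IsProjectiveMap g) : g = 0 := by
  cases hg with
  | zero => rfl
  | smul_id c =>
    by_cases hc : c = 0
    · simp [hc]
    · refine absurd ?_ (hS.not_isProjectiveMap_id i)
      have := (projectiveMaps k A (S i) (S i)).smul_mem c⁻¹ hp
      rwa [inv_smul_smul₀ hc] at this

/-- A map between members of `S` that is not projective is an isomorphism up to a projective
map. -/
theorem exists_bijective {i j : ι} {g : S i →ₗ[A] S j} (hg : ¬ IsProjectiveMap g) :
    ∃ g₀ : S i →ₗ[A] S j, Function.Bijective g₀ ∧ IsProjectiveMap (g - g₀) := by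
  obtain ⟨g₀, h₀, hp⟩ := hS.exists_isScalarMap g
  refine ⟨g₀, ?_, hp⟩
  have h1 : g₀ ≠ 0 := by
    rintro rfl
    exact hg (by simpa using hp)
  cases h₀ with
  | zero => exact absurd rfl h1
  | smul_id c =>
    have hc : c ≠ 0 := by
      rintro rfl
      simp at h1
    exact (LinearEquiv.smulOfNeZero k (S i) c hc).bijective

end IsStablyOrthogonal

end Scalar

/-! ### Kernels of restrictions to kernels -/

section Linear

variable {A : Type*} [Ring A] {M N N' X Y : Type*} [AddCommGroup M] [Module A M]
  [AddCommGroup N] [Module A N] [AddCommGroup N'] [Module A N']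
  [AddCommGroup X] [Module A X] [AddCommGroup Y] [Module A Y]

theorem nonempty_linearEquiv_of_range_eq {i : N →ₗ[A] M} {i' : N' →ₗ[A] M}
    (hi : Function.Injective i) (hi' : Function.Injective i')
    (h : LinearMap.range i = LinearMap.range i') : Nonempty (N ≃ₗ[A] N') :=
  ⟨(LinearEquiv.ofInjective i hi).trans
    ((LinearEquiv.ofEq _ _ h).trans (LinearEquiv.ofInjective i' hi').symm)⟩

/-- If `f` is surjective on `ker q`, then `q` is surjective on `ker f`. -/
theorem surjective_comp_ker_subtype {q : M →ₗ[A] X} {f : M →ₗ[A] Y}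
    (hq : Function.Surjective q)
    (hf : Function.Surjective (f ∘ₗ (LinearMap.ker q).subtype)) :
    Function.Surjective (q ∘ₗ (LinearMap.ker f).subtype) := by
  intro x
  obtain ⟨m, rfl⟩ := hq x
  obtain ⟨l, hl⟩ := hf (f m)
  refine ⟨⟨m - l, ?_⟩, ?_⟩
  · simp only [LinearMap.comp_apply, Submodule.subtype_apply] at hl
    simp [hl]
  · simp

/-- Both sides are `ker q ⊓ ker f`. This is what allows two layers of a filtration to be exchanged.
-/
theorem nonempty_ker_comp_ker_subtype_equiv (q : M →ₗ[A] X) (f : M →ₗ[A] Y) :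
    Nonempty (LinearMap.ker (f ∘ₗ (LinearMap.ker q).subtype) ≃ₗ[A]
      LinearMap.ker (q ∘ₗ (LinearMap.ker f).subtype)) := by
  refine nonempty_linearEquiv_of_range_eq
    (i := (LinearMap.ker q).subtype ∘ₗ Submodule.subtype _)
    (i' := (LinearMap.ker f).subtype ∘ₗ Submodule.subtype _)
    (Subtype.val_injective.comp Subtype.val_injective)
    (Subtype.val_injective.comp Subtype.val_injective) ?_
  ext x
  simp [and_comm]

end Linear

/-! ### Filtrations with one member of `S` per layer, and projective submodules -/

section Filtered

universe v w w'

variable (A : Type*) [Ring A] {ι : Type*} (S : ι → Type*) [∀ i, AddCommGroup (S i)]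
  [∀ i, Module A (S i)]

/-- `M` has a filtration of length `n` whose successive quotients are members of `S`. -/
def IsFiltered : ℕ → ∀ (M : Type v) [AddCommGroup M] [Module A M], Prop
  | 0, M, _, _ => Subsingleton M
  | n + 1, M, _, _ =>
    ∃ (i : ι) (q : M →ₗ[A] S i), Function.Surjective q ∧ IsFiltered n (LinearMap.ker q)

variable {A S} {M : Type v} {N : Type w} {X : Type w'} [AddCommGroup M] [Module A M]
  [AddCommGroup N] [Module A N] [AddCommGroup X] [Module A X]

theorem IsFiltered.of_equiv {n : ℕ} (hM : IsFiltered A S n M) (e : M ≃ₗ[A] N) :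
    IsFiltered A S n N := by
  induction n generalizing M N with
  | zero =>
    have : Subsingleton M := hM
    exact e.symm.injective.subsingleton
  | succ n ih =>
    obtain ⟨i, q, hq, h⟩ := hM
    refine ⟨i, q ∘ₗ e.symm, hq.comp e.symm.surjective, ?_⟩
    obtain ⟨e'⟩ := nonempty_linearEquiv_of_range_eq (i := (LinearMap.ker q).subtype)
      (i' := (e.symm : N →ₗ[A] M) ∘ₗ (LinearMap.ker (q ∘ₗ (e.symm : N →ₗ[A] M))).subtype)
      Subtype.val_injective (e.symm.injective.comp Subtype.val_injective) (by
        ext x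
        simp only [Submodule.range_subtype, LinearMap.mem_ker, LinearMap.mem_range]
        constructor
        · intro hx
          exact ⟨⟨e x, by simpa using hx⟩, by simp⟩
        · rintro ⟨y, rfl⟩
          exact y.2)
    exact ih h e'

/-- Pull the filtration of `X` back along `q`: if `r` is the top layer of `X`, then `ker (r ∘ₗ q)`
is an extension of `ker r` by `ker q`. -/
theorem IsFiltered.of_ker {m n : ℕ} (hX : IsFiltered A S m X) {q : M →ₗ[A] X}
    (hq : Function.Surjective q) (hk : IsFiltered A S n (LinearMap.ker q)) :
    IsFiltered A S (n + m) M := by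
  induction m generalizing M X with
  | zero =>
    have : Subsingleton X := hX
    refine hk.of_equiv (LinearEquiv.ofTop _ ?_)
    rw [LinearMap.ker_eq_top]
    ext
    exact Subsingleton.elim _ _
  | succ m ih =>
    obtain ⟨i, r, hr, h⟩ := hX
    refine ⟨i, r ∘ₗ q, hr.comp hq, ?_⟩
    let q' : LinearMap.ker (r ∘ₗ q) →ₗ[A] LinearMap.ker r :=
      q.restrict fun x hx => hx
    refine ih h (q := q') ?_ ?_
    · rintro ⟨y, hy⟩
      obtain ⟨x, rfl⟩ := hq y
      exact ⟨⟨x, hy⟩, rfl⟩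
    · obtain ⟨e⟩ := nonempty_linearEquiv_of_range_eq (i := (LinearMap.ker q).subtype)
        (i' := (LinearMap.ker (r ∘ₗ q)).subtype ∘ₗ (LinearMap.ker q').subtype)
        Subtype.val_injective (Subtype.val_injective.comp Subtype.val_injective) (by
          ext x
          simp only [Submodule.range_subtype, LinearMap.mem_ker, LinearMap.mem_range]
          constructor
          · intro hx
            exact ⟨⟨⟨x, by simp [hx]⟩, Subtype.ext hx⟩, rfl⟩
          · rintro ⟨y, rfl⟩
            exact congrArg Subtype.val y.2)
      exact hk.of_equiv e

theorem IsFiltered.of_exact {m n : ℕ} (hN : IsFiltered A S n N) (hX : IsFiltered A S m X)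
    {i : N →ₗ[A] M} {q : M →ₗ[A] X} (hi : Function.Injective i) (hq : Function.Surjective q)
    (h : LinearMap.range i = LinearMap.ker q) : IsFiltered A S (n + m) M := by
  obtain ⟨e⟩ := nonempty_linearEquiv_of_range_eq hi (LinearMap.ker q).injective_subtype
    (by simpa using h)
  exact hX.of_ker hq (hN.of_equiv e)

theorem isFiltered_pi (n : ℕ) (c : Fin n → ι) :
    IsFiltered A S n ((j : Fin n) → S (c j)) := by
  induction n with
  | zero => exact inferInstanceAs (Subsingleton ((j : Fin 0) → S (c j)))
  | succ n ih =>
    refine ⟨c 0, LinearMap.proj 0, LinearMap.proj_surjective 0, ?_⟩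
    let t : LinearMap.ker (LinearMap.proj 0 : ((j : Fin (n + 1)) → S (c j)) →ₗ[A] S (c 0))
        →ₗ[A] ((j : Fin n) → S (c j.succ)) :=
      LinearMap.pi (fun j => LinearMap.proj j.succ) ∘ₗ Submodule.subtype _
    refine (ih fun j => c j.succ).of_equiv (LinearEquiv.ofBijective t ⟨?_, ?_⟩).symm
    · rw [← LinearMap.ker_eq_bot, eq_bot_iff]
      rintro ⟨x, hx⟩ h
      refine Subtype.ext (funext fun j => ?_)
      refine Fin.cases hx (fun j => ?_) j
      exact congrFun (LinearMap.mem_ker.1 h) j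
    · intro y
      exact ⟨⟨Fin.cons 0 y, by simp⟩, by ext j; simp [t]⟩

theorem isFiltered_one (i : ι) : IsFiltered A S 1 (S i) :=
  ⟨i, LinearMap.id, Function.surjective_id, by
    rw [LinearMap.ker_id]
    exact inferInstanceAs (Subsingleton (⊥ : Submodule A (S i)))⟩

theorem IsFiltered.finite [∀ i, Module.Finite A (S i)] {n : ℕ} (hM : IsFiltered A S n M) :
    Module.Finite A M := by
  induction n generalizing M with
  | zero =>
    have : Subsingleton M := hM
    infer_instance
  | succ n ih =>
    obtain ⟨i, q, hq, h⟩ := hM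
    have := ih h
    have := Module.Finite.equiv (q.quotKerEquivOfSurjective hq).symm
    exact Module.Finite.of_submodule_quotient (LinearMap.ker q)

theorem IsInAdd.exists_surjective {L : Submodule A M} (h : IsInAdd A S (M ⧸ L)) :
    ∃ (n : ℕ) (c : Fin n → ι) (q : M →ₗ[A] ((j : Fin n) → S (c j))),
      Function.Surjective q ∧ LinearMap.ker q = L := by
  obtain ⟨n, c, ⟨e⟩⟩ := h
  exact ⟨n, c, e ∘ₗ L.mkQ, e.surjective.comp L.mkQ_surjective, by simp⟩

theorem isInAdd_of_surjective {n : ℕ} {c : Fin n → ι} {q : M →ₗ[A] ((j : Fin n) → S (c j))}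
    (hq : Function.Surjective q) {L : Submodule A M} (h : LinearMap.ker q = L) :
    IsInAdd A S (M ⧸ L) := by
  subst h
  exact ⟨n, c, ⟨q.quotKerEquivOfSurjective hq⟩⟩

/-- Surjectivity of `g` on `ker q` makes `(g, q)` jointly surjective. This supplies the smaller
competitor that contradicts minimality. -/
theorem isInAdd_quotient_ker_inf_ker {i : ι} {n : ℕ} {c : Fin n → ι}
    {q : M →ₗ[A] ((j : Fin n) → S (c j))} {g : M →ₗ[A] S i} (hq : Function.Surjective q)
    (hg : Function.Surjective (g ∘ₗ (LinearMap.ker q).subtype)) :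
    IsInAdd A S (M ⧸ (LinearMap.ker q ⊓ LinearMap.ker g)) := by
  let e : (S i × ((j : Fin n) → S (c j))) ≃ₗ[A]
      ((j : Fin (n + 1)) → S ((Fin.cons i c : Fin (n + 1) → ι) j)) :=
    Fin.consLinearEquiv A fun j => S ((Fin.cons i c : Fin (n + 1) → ι) j)
  have hs : Function.Surjective (g.prod q) := by
    rintro ⟨y, z⟩
    obtain ⟨⟨a, ha⟩, ha'⟩ := surjective_comp_ker_subtype hq hg z
    obtain ⟨⟨b, hb⟩, hb'⟩ := hg y
    refine ⟨a + b, Prod.ext ?_ ?_⟩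
    · simpa [LinearMap.mem_ker.1 ha] using hb'
    · simpa [LinearMap.mem_ker.1 hb] using ha'
  refine isInAdd_of_surjective (n := n + 1) (c := Fin.cons i c)
    (q := (e : _ →ₗ[A] _) ∘ₗ g.prod q) (e.surjective.comp hs) ?_
  rw [LinearMap.ker_comp_of_ker_eq_bot _ e.ker, LinearMap.ker_prod, inf_comm]

theorem IsFiltrable.exists_isFiltered (h : IsFiltrable A S M) : ∃ n, IsFiltered A S n M := by
  obtain ⟨r, F, h0, hr, hF⟩ := h
  -- Climb from the bottom term `F r = ⊥`, refining each layer in `add S` into single members.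
  have key : ∀ j ≤ r, ∃ n, IsFiltered A S n (F (r - j)) := by
    intro j
    induction j with
    | zero =>
      intro _
      refine ⟨0, ?_⟩
      rw [Nat.sub_zero, hr]
      exact inferInstanceAs (Subsingleton (⊥ : Submodule A M))
    | succ j ih =>
      intro hj
      obtain ⟨n, hn⟩ := ih (by omega)
      obtain ⟨hle, hadd⟩ := hF (r - (j + 1)) (by omega)
      rw [show r - (j + 1) + 1 = r - j by omega] at hle hadd
      obtain ⟨m, c, q, hq, hk⟩ := hadd.exists_surjective
      refine ⟨n + m, (isFiltered_pi m c).of_ker hq ?_⟩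
      rw [hk]
      exact hn.of_equiv (Submodule.submoduleOfEquivOfLe hle).symm
  obtain ⟨n, hn⟩ := key r le_rfl
  rw [Nat.sub_self, h0] at hn
  exact ⟨n, hn.of_equiv Submodule.topEquiv⟩

theorem IsFiltered.isFiltrable {n : ℕ} (h : IsFiltered A S n M) : IsFiltrable A S M := by
  induction n generalizing M with
  | zero =>
    have : Subsingleton M := h
    exact ⟨0, fun _ => ⊤, rfl, Subsingleton.elim _ _, by simp⟩
  | succ n ih =>
    obtain ⟨i, q, hq, h⟩ := h
    obtain ⟨r, F, h0, hr, hF⟩ := ih h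
    let K := LinearMap.ker q
    refine ⟨r + 1, fun j => Nat.casesOn j ⊤ fun j => (F j).map K.subtype, rfl, ?_, ?_⟩
    · simp [hr]
    · intro j hj
      rcases j with _ | j
      · refine ⟨le_top, isInAdd_of_surjective (n := 1) (c := fun _ => i)
          (q := LinearMap.pi (fun _ => q) ∘ₗ (⊤ : Submodule A M).subtype) ?_ ?_⟩
        · intro y
          obtain ⟨x, hx⟩ := hq (y 0)
          refine ⟨⟨x, trivial⟩, funext fun a => ?_⟩
          rw [Subsingleton.elim a 0]
          exact hx
        · ext x
          simp [h0, Submodule.submoduleOf, K, funext_iff]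
      · obtain ⟨hle, hadd⟩ := hF j (by omega)
        obtain ⟨m, c, p, hp, hk⟩ := hadd.exists_surjective
        let e := (F j).equivMapOfInjective K.subtype K.injective_subtype
        refine ⟨Submodule.map_mono hle, isInAdd_of_surjective (q := p ∘ₗ e.symm)
          (hp.comp e.symm.surjective) ?_⟩
        ext x
        obtain ⟨y, rfl⟩ := e.surjective x
        have : p y = 0 ↔ (y : K) ∈ F (j + 1) := by
          rw [← LinearMap.mem_ker, hk]
          rfl
        simp [Submodule.submoduleOf, this, e]

/-- `M ⧸ P` is an extension of `M ⧸ N` by `N ⧸ P`. -/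
theorem IsFiltered.quotient_map_subtype {m n : ℕ} {N : Submodule A M} {P : Submodule A N}
    (h : IsFiltered A S n (N ⧸ P)) (h' : IsFiltered A S m (M ⧸ N)) :
    IsFiltered A S (n + m) (M ⧸ P.map N.subtype) := by
  have hle : P.map N.subtype ≤ N := Submodule.map_subtype_le N P
  refine h.of_exact h' (i := P.mapQ (P.map N.subtype) N.subtype (Submodule.le_comap_map _ _))
    (q := Submodule.factor hle) ?_ (Submodule.factor_surjective hle) ?_
  · rw [← LinearMap.ker_eq_bot, Submodule.ker_mapQ,
      Submodule.comap_map_eq_of_injective N.injective_subtype, Submodule.mkQ_map_self]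
  · rw [Submodule.range_mapQ, Submodule.range_subtype, Submodule.factor, Submodule.ker_mapQ,
      Submodule.comap_id]

variable (A S) in
/-- `M` has no nonzero projective submodule with filtered quotient. -/
def HasNoProjectiveSubmodule (M : Type v) [AddCommGroup M] [Module A M] : Prop :=
  ∀ (P : Submodule A M) (n : ℕ), Module.Projective A P → IsFiltered A S n (M ⧸ P) → P = ⊥

theorem HasNoProjectiveSubmodule.of_equiv (h : HasNoProjectiveSubmodule A S M)
    (e : M ≃ₗ[A] N) : HasNoProjectiveSubmodule A S N := by
  intro P n hP hn
  have h1 := h (P.comap (e : M →ₗ[A] N)) n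
    (Module.Projective.of_equiv (e.ofSubmodule' P).symm)
    (hn.of_equiv (Submodule.Quotient.equiv _ _ e (by
      exact Submodule.map_comap_eq_of_surjective e.surjective P)).symm)
  rw [← Submodule.map_comap_eq_of_surjective (f := (e : M →ₗ[A] N)) e.surjective P, h1,
    Submodule.map_bot]

/-- Extensions of filtered quotients are filtered, so the condition descends along a radical
filtration, as the induction requires. -/
theorem HasNoProjectiveSubmodule.submodule (h : HasNoProjectiveSubmodule A S M) {m : ℕ}
    {N : Submodule A M} (hN : IsFiltered A S m (M ⧸ N)) : HasNoProjectiveSubmodule A S N := by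
  intro P n hP hn
  have h1 := h (P.map N.subtype) (n + m)
    (Module.Projective.of_equiv (P.equivMapOfInjective _ N.injective_subtype))
    (hn.quotient_map_subtype hN)
  exact Submodule.map_injective_of_injective N.injective_subtype (by rw [h1, Submodule.map_bot])

theorem HasNoProjectiveRemainder.hasNoProjectiveSubmodule (hinj : Module.Injective A A)
    [IsNoetherian A M] (h : HasNoProjectiveRemainder A S M) :
    HasNoProjectiveSubmodule A S M := by
  intro P n hP hn
  by_contra hne
  -- `P` is injective, so it has a retraction `g`; then `ker g` is a complement isomorphic to the
  -- filtered quotient `M ⧸ P`.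
  obtain ⟨g, hg⟩ := exists_extension_of_projective hinj P.injective_subtype LinearMap.id
  have hc : IsCompl P (LinearMap.ker g) :=
    LinearMap.isCompl_of_proj fun x => LinearMap.congr_fun hg x
  exact h ⟨LinearMap.ker g, P, hc.symm, hne, hP,
    (hn.of_equiv (Submodule.quotientEquivOfIsCompl P _ hc)).isFiltrable⟩

end Filtered

/-! ### Correcting maps by projective maps; universality of minimal quotients -/

section Modification

universe u v w

variable {k : Type*} {A : Type u} [Field k] [Ring A] [Algebra k A] {ι : Type*}
  {S : ι → Type*} [∀ i, AddCommGroup (S i)] [∀ i, Module k (S i)] [∀ i, Module A (S i)]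
  [∀ i, IsScalarTower k A (S i)] {M : Type v} [AddCommGroup M] [Module A M]

/-- A map to a member of `S` that is not projective, but projective on the kernel of a surjection
to a member of `S`, can be changed by a projective map into a surjection with the same kernel. -/
theorem exists_surjective_of_isProjectiveMap_restrict (hS : IsStablyOrthogonal k A S)
    (hinj : Module.Injective A A) {i j : ι} {q : M →ₗ[A] S i} (hq : Function.Surjective q)
    {f : M →ₗ[A] S j} (hf : ¬ IsProjectiveMap f)
    (hr : IsProjectiveMap (f ∘ₗ (LinearMap.ker q).subtype)) :
    ∃ g : M →ₗ[A] S j, IsProjectiveMap (g - f) ∧ Function.Surjective g ∧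
      LinearMap.ker g = LinearMap.ker q := by
  obtain ⟨g, hg⟩ := exists_factor_of_isProjectiveMap_restrict hinj hq f hr
  have hg' : ¬ IsProjectiveMap g := fun h => hf (by simpa using hg.add (h.comp_right q))
  obtain ⟨g₀, hb, hp⟩ := hS.exists_bijective hg'
  refine ⟨g₀ ∘ₗ q, ?_, hb.surjective.comp hq,
    LinearMap.ker_comp_of_ker_eq_bot _ (LinearMap.ker_eq_bot.2 hb.injective)⟩
  convert (hg.add (hp.comp_right q)).neg using 1
  rw [LinearMap.sub_comp]
  abel

/-- A map to a member of `S` that is not projective can be changed by a projective map into a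
surjection with filtered kernel. -/
theorem IsFiltered.exists_surjective_of_not_isProjectiveMap (hS : IsStablyOrthogonal k A S)
    (hinj : Module.Injective A A) {n : ℕ} (hM : IsFiltered A S (n + 1) M) {j : ι}
    {f : M →ₗ[A] S j} (hf : ¬ IsProjectiveMap f) :
    ∃ g : M →ₗ[A] S j, IsProjectiveMap (g - f) ∧ Function.Surjective g ∧
      IsFiltered A S n (LinearMap.ker g) := by
  induction n generalizing M with
  | zero =>
    obtain ⟨i, q, hq, hk⟩ := hM
    have : Subsingleton (LinearMap.ker q) := hk
    obtain ⟨g, hg, hs, hgk⟩ := exists_surjective_of_isProjectiveMap_restrict hS hinj hq hf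
      (.of_subsingleton_left _)
    exact ⟨g, hg, hs, by rwa [hgk]⟩
  | succ n ih =>
    obtain ⟨i, q, hq, hk⟩ := hM
    -- If `f` is projective on `ker q`, then it factors stably through the top layer. Otherwise
    -- correct it on the shorter module `ker q` and extend the correction; the new kernel has top
    -- layer `S i`, with `ker q ⊓ ker (f + p)` below it.
    by_cases hr : IsProjectiveMap (f ∘ₗ (LinearMap.ker q).subtype)
    · obtain ⟨g, hg, hs, hgk⟩ := exists_surjective_of_isProjectiveMap_restrict hS hinj hq hf hr
      exact ⟨g, hg, hs, by rwa [hgk]⟩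
    · obtain ⟨g, hg, hs, hgk⟩ := ih hk hr
      obtain ⟨p, hp, hpe⟩ := hg.exists_extension hinj (LinearMap.ker q).injective_subtype
      have he : (f + p) ∘ₗ (LinearMap.ker q).subtype = g := by
        rw [LinearMap.add_comp, hpe]
        abel
      refine ⟨f + p, by simpa using hp, ?_, i, q ∘ₗ (LinearMap.ker (f + p)).subtype,
        surjective_comp_ker_subtype hq (he ▸ hs), ?_⟩
      · rw [← he] at hs
        exact Function.Surjective.of_comp hs
      · obtain ⟨e⟩ := nonempty_ker_comp_ker_subtype_equiv q (f + p)
        rw [he] at e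
        exact hgk.of_equiv e

/-- Extension to the whole module of a modification on the kernel of a surjection. -/
theorem exists_extension_surjective_on_ker (hS : IsStablyOrthogonal k A S)
    (hinj : Module.Injective A A) {X : Type w} [AddCommGroup X] [Module A X] {n : ℕ}
    {q : M →ₗ[A] X} (hk : IsFiltered A S (n + 1) (LinearMap.ker q)) {j : ι} {f : M →ₗ[A] S j}
    (hf : ¬ IsProjectiveMap (f ∘ₗ (LinearMap.ker q).subtype)) :
    ∃ g : M →ₗ[A] S j, IsProjectiveMap (g - f) ∧
      Function.Surjective (g ∘ₗ (LinearMap.ker q).subtype) ∧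
      IsFiltered A S n (LinearMap.ker (g ∘ₗ (LinearMap.ker q).subtype)) := by
  obtain ⟨g, hg, hs, hgk⟩ := hk.exists_surjective_of_not_isProjectiveMap hS hinj hf
  obtain ⟨p, hp, hpe⟩ := hg.exists_extension hinj (LinearMap.ker q).injective_subtype
  have he : (f + p) ∘ₗ (LinearMap.ker q).subtype = g := by
    rw [LinearMap.add_comp, hpe]
    abel
  refine ⟨f + p, by simpa using hp, ?_⟩
  rw [he]
  exact ⟨hs, hgk⟩

/-- If all maps from `M` to members of `S` are projective, so are those to filtered modules. -/
theorem IsFiltered.isProjectiveMap {n : ℕ} {N : Type w} [AddCommGroup N] [Module A N]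
    (hN : IsFiltered A S n N) (h : ∀ j (f : M →ₗ[A] S j), IsProjectiveMap f)
    (f : M →ₗ[A] N) : IsProjectiveMap f := by
  induction n generalizing N with
  | zero =>
    have : Subsingleton N := hN
    have : f = 0 := by
      ext
      exact Subsingleton.elim _ _
    rw [this]
    exact .zero
  | succ n ih =>
    obtain ⟨i, q, hq, hk⟩ := hN
    -- Subtracting a projective lift of `q ∘ₗ f` moves `f` into `ker q`, where the induction
    -- applies.
    obtain ⟨p, hp, hpe⟩ := (h i (q ∘ₗ f)).exists_lift hq
    have hx : ∀ x, (f - p) x ∈ LinearMap.ker q := fun x => by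
      have := LinearMap.congr_fun hpe x
      simp only [LinearMap.comp_apply] at this
      simp [this]
    have h1 := (ih hk ((f - p).codRestrict _ hx)).comp_left (LinearMap.ker q).subtype
    rw [LinearMap.subtype_comp_codRestrict] at h1
    simpa using h1.add hp

/-- A surjection to a member of `S` with filtered kernel can be projective only if `M` has a
nonzero projective submodule with filtered quotient. -/
theorem exists_projective_submodule (hS : IsStablyOrthogonal k A S)
    (hinj : Module.Injective A A) {n : ℕ} {i : ι} {q : M →ₗ[A] S i}
    (hq : Function.Surjective q) (hp : IsProjectiveMap q)
    (hk : IsFiltered A S n (LinearMap.ker q)) :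
    ∃ (P : Submodule A M) (m : ℕ), Module.Projective A P ∧ IsFiltered A S m (M ⧸ P) ∧
      P ≠ ⊥ := by
  induction n generalizing M with
  | zero =>
    have hb : Function.Bijective q := by
      refine ⟨?_, hq⟩
      rw [← LinearMap.ker_eq_bot, Submodule.eq_bot_iff]
      have : Subsingleton (LinearMap.ker q) := hk
      exact fun x hx => congrArg Subtype.val (Subsingleton.elim (⟨x, hx⟩ : LinearMap.ker q) 0)
    refine absurd ?_ (hS.not_isProjectiveMap_id i)
    convert hp.comp_right ((LinearEquiv.ofBijective q hb).symm : S i →ₗ[A] M) using 1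
    ext x
    exact ((LinearEquiv.ofBijective q hb).apply_symm_apply x).symm
  | succ n ih =>
    -- If all maps to `S` are projective, so is the identity of the filtered module `M`, and `⊤` is
    -- the required submodule. Otherwise a non-projective map is corrected to `g`, and the induction
    -- runs on `q` restricted to `ker g`, whose kernel is one layer shorter.
    by_cases hall : ∀ j (f : M →ₗ[A] S j), IsProjectiveMap f
    · have hM : IsFiltered A S (n + 2) M := ⟨i, q, hq, hk⟩
      have := (hM.isProjectiveMap hall LinearMap.id).module_projective
      have := (hS.indecomposable i).1
      have := hq.nontrivial
      exact ⟨⊤, 0, Module.Projective.of_equiv Submodule.topEquiv.symm,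
        inferInstanceAs (Subsingleton (M ⧸ (⊤ : Submodule A M))), top_ne_bot⟩
    · push Not at hall
      obtain ⟨j, f, hf⟩ := hall
      -- Were `f` projective on `ker q`, it would factor stably through `q`, which is itself
      -- projective.
      have hr : ¬ IsProjectiveMap (f ∘ₗ (LinearMap.ker q).subtype) := fun hr => by
        obtain ⟨g, hg⟩ := exists_factor_of_isProjectiveMap_restrict hinj hq f hr
        exact hf (by simpa using hg.add (hp.comp_left g))
      obtain ⟨g, hg, hs, hgk⟩ := exists_extension_surjective_on_ker hS hinj hk hr
      obtain ⟨e⟩ := nonempty_ker_comp_ker_subtype_equiv q g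
      obtain ⟨P, m, hP, hm, hne⟩ := ih (surjective_comp_ker_subtype hq hs) (hp.comp_right _)
        (hgk.of_equiv e)
      have hgs : Function.Surjective g := Function.Surjective.of_comp hs
      refine ⟨P.map (LinearMap.ker g).subtype, m + 1,
        Module.Projective.of_equiv (P.equivMapOfInjective _ (Submodule.injective_subtype _)),
        hm.quotient_map_subtype ((isFiltered_one j).of_equiv
          (g.quotKerEquivOfSurjective hgs).symm), fun h => hne ?_⟩
      exact Submodule.map_injective_of_injective (LinearMap.ker g).injective_subtype
        (by rw [h, Submodule.map_bot])

/-- Every map from `M` to a member of `S` factors uniquely through `q` in the stable category. -/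
structure IsStablyUniversal (S : ι → Type*) [∀ i, AddCommGroup (S i)] [∀ i, Module A (S i)]
    {X : Type w} [AddCommGroup X] [Module A X] (q : M →ₗ[A] X) : Prop where
  exists_factor : ∀ i (h : M →ₗ[A] S i), ∃ g : X →ₗ[A] S i, IsProjectiveMap (h - g ∘ₗ q)
  isProjectiveMap : ∀ i (g : X →ₗ[A] S i), IsProjectiveMap (g ∘ₗ q) → IsProjectiveMap g

theorem IsMinimalFiltrable.isStablyUniversal (hS : IsStablyOrthogonal k A S)
    (hinj : Module.Injective A A) (hM : HasNoProjectiveSubmodule A S M) {L : Submodule A M}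
    (hL : IsMinimalFiltrable A S L) {n : ℕ} {c : Fin n → ι}
    {q : M →ₗ[A] ((j : Fin n) → S (c j))} (hq : Function.Surjective q)
    (hk : LinearMap.ker q = L) : IsStablyUniversal S q := by
  subst hk
  obtain ⟨m, hm⟩ := hL.prop.1.exists_isFiltered
  constructor
  · intro i h
    refine exists_factor_of_isProjectiveMap_restrict hinj hq h (by_contra fun hr => ?_)
    rcases m with _ | m
    · have : Subsingleton (LinearMap.ker q) := hm
      exact hr (.of_subsingleton_left _)
    obtain ⟨g, -, hs, hgk⟩ := exists_extension_surjective_on_ker hS hinj hm hr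
    have hf : IsFiltrable A S (LinearMap.ker q ⊓ LinearMap.ker g : Submodule A M) := by
      obtain ⟨e⟩ := nonempty_linearEquiv_of_range_eq
        (i := (LinearMap.ker q).subtype ∘ₗ
          (LinearMap.ker (g ∘ₗ (LinearMap.ker q).subtype)).subtype)
        (i' := (LinearMap.ker q ⊓ LinearMap.ker g).subtype)
        (Subtype.val_injective.comp Subtype.val_injective) Subtype.val_injective (by
          rw [LinearMap.range_comp, Submodule.range_subtype, Submodule.range_subtype,
            LinearMap.ker_comp, Submodule.map_comap_subtype])
      exact (hgk.of_equiv e).isFiltrable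
    -- Minimality forces `ker q ≤ ker g`, although `g` maps `ker q` onto the nonzero module `S i`.
    have hle := hL.le_of_le ⟨hf, isInAdd_quotient_ker_inf_ker hq hs⟩ inf_le_left
    have := (hS.indecomposable i).1
    obtain ⟨y, hy⟩ := exists_ne (0 : S i)
    obtain ⟨x, rfl⟩ := hs y
    exact hy (hle x.2).2
  · intro i g hg
    by_contra hng
    rcases n with _ | n
    · exact hng (.of_subsingleton_left _)
    obtain ⟨g', hp, hs, hgk⟩ :=
      (isFiltered_pi (n + 1) c).exists_surjective_of_not_isProjectiveMap hS hinj hng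
    have hpq : IsProjectiveMap (g' ∘ₗ q) := by
      simpa [LinearMap.sub_comp] using (hp.comp_right q).add hg
    -- This kernel is an extension of `ker g'` by `ker q`, so the projective surjection `g' ∘ₗ q`
    -- has filtered kernel.
    have hM' : IsFiltered A S (m + n) (LinearMap.ker (g' ∘ₗ q)) := by
      let r : LinearMap.ker (g' ∘ₗ q) →ₗ[A] LinearMap.ker g' := q.restrict fun x hx => hx
      refine hm.of_exact hgk (i := Submodule.inclusion (LinearMap.ker_le_ker_comp q g')) (q := r)
        (Submodule.inclusion_injective _) ?_ ?_
      · rintro ⟨y, hy⟩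
        obtain ⟨x, rfl⟩ := hq y
        exact ⟨⟨x, hy⟩, rfl⟩
      · ext ⟨x, hx⟩
        rw [LinearMap.mem_ker, ← Subtype.coe_inj, Submodule.range_inclusion]
        exact Iff.rfl
    obtain ⟨P, l, hP, hl, hne⟩ := exists_projective_submodule hS hinj
      (q := g' ∘ₗ q) (hs.comp hq) hpq hM'
    exact hne (hM P l hP hl)

end Modification

/-! ### Stable isomorphisms: restriction to kernels and extension from them -/

section StablyEq

universe u v₁ v₂ v₃ v₄

variable {A : Type u} [Ring A] {M : Type v₁} {N : Type v₂} {X : Type v₃} {Y : Type v₄}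
  [AddCommGroup M] [Module A M] [AddCommGroup N] [Module A N]
  [AddCommGroup X] [Module A X] [AddCommGroup Y] [Module A Y]

/-- Two maps are stably equal if their difference is projective. -/
def StablyEq (f g : M →ₗ[A] N) : Prop := IsProjectiveMap (f - g)

namespace StablyEq

theorem refl (f : M →ₗ[A] N) : StablyEq f f := by
  rw [StablyEq, sub_self]
  exact .zero

theorem symm {f g : M →ₗ[A] N} (h : StablyEq f g) : StablyEq g f := by
  rw [StablyEq, ← neg_sub]
  exact h.neg

theorem trans {f g h : M →ₗ[A] N} (h₁ : StablyEq f g) (h₂ : StablyEq g h) : StablyEq f h := by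
  rw [StablyEq, ← sub_add_sub_cancel f g h]
  exact h₁.add h₂

theorem comp_left {f g : M →ₗ[A] N} (h : StablyEq f g) (a : N →ₗ[A] X) :
    StablyEq (a ∘ₗ f) (a ∘ₗ g) := by
  rw [StablyEq, ← LinearMap.comp_sub]
  exact IsProjectiveMap.comp_left h a

theorem comp_right {f g : M →ₗ[A] N} (h : StablyEq f g) (a : X →ₗ[A] M) :
    StablyEq (f ∘ₗ a) (g ∘ₗ a) := by
  rw [StablyEq, ← LinearMap.sub_comp]
  exact IsProjectiveMap.comp_right h a

theorem comp {f g : M →ₗ[A] N} {a b : X →ₗ[A] M} (h : StablyEq f g) (h' : StablyEq a b) :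
    StablyEq (f ∘ₗ a) (g ∘ₗ b) :=
  (h.comp_right a).trans (h'.comp_left g)

/-- A stable factorization through a surjection can be made strict. -/
theorem exists_lift {f : M →ₗ[A] N} {q : N →ₗ[A] X} (hq : Function.Surjective q)
    {h : M →ₗ[A] X} (hf : StablyEq h (q ∘ₗ f)) :
    ∃ f' : M →ₗ[A] N, StablyEq f' f ∧ q ∘ₗ f' = h := by
  obtain ⟨p, hp, hpe⟩ := IsProjectiveMap.exists_lift hf hq
  refine ⟨f + p, by simpa [StablyEq] using hp, ?_⟩
  rw [LinearMap.comp_add, hpe]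
  abel

end StablyEq

/-- `f` is invertible in the stable category. -/
def IsStableIso (f : M →ₗ[A] N) : Prop :=
  ∃ g : N →ₗ[A] M, StablyEq (g ∘ₗ f) LinearMap.id ∧ StablyEq (f ∘ₗ g) LinearMap.id

theorem _root_.LinearEquiv.isStableIso (e : M ≃ₗ[A] N) : IsStableIso (e : M →ₗ[A] N) :=
  ⟨e.symm, by simpa using StablyEq.refl _, by simpa using StablyEq.refl _⟩

namespace IsStableIso

theorem comp {f : N →ₗ[A] X} {g : M →ₗ[A] N} (hf : IsStableIso f) (hg : IsStableIso g) :
    IsStableIso (f ∘ₗ g) := by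
  obtain ⟨f', h₁, h₂⟩ := hf
  obtain ⟨g', h₃, h₄⟩ := hg
  refine ⟨g' ∘ₗ f', ?_, ?_⟩
  · exact ((h₁.comp_right g).comp_left g').trans h₃
  · exact ((h₄.comp_right f').comp_left f).trans h₂

theorem congr {f f' : M →ₗ[A] N} (hf : IsStableIso f) (h : StablyEq f' f) :
    IsStableIso f' := by
  obtain ⟨g, h₁, h₂⟩ := hf
  exact ⟨g, (h.comp_left g).trans h₁, (h.comp_right g).trans h₂⟩

theorem of_inverses {f : M →ₗ[A] N} {g g' : N →ₗ[A] M} (h : StablyEq (g ∘ₗ f) LinearMap.id)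
    (h' : StablyEq (f ∘ₗ g') LinearMap.id) : IsStableIso f := by
  have : StablyEq g g' := (h'.comp_left g).symm.trans (h.comp_right g')
  exact ⟨g, h, (this.comp_left f).trans h'⟩

/-- If `g ∘ f - id` and `f ∘ g - id` have projective squares, then `f` is a stable isomorphism. -/
theorem of_sq {f : M →ₗ[A] N} {g : N →ₗ[A] M}
    (h : IsProjectiveMap ((g ∘ₗ f - LinearMap.id) ∘ₗ (g ∘ₗ f - LinearMap.id)))
    (h' : IsProjectiveMap ((f ∘ₗ g - LinearMap.id) ∘ₗ (f ∘ₗ g - LinearMap.id))) :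
    IsStableIso f := by
  -- If `x = g ∘ₗ f`, then `(2 - x) x = 1 - (x - 1) ^ 2`, so `2 - x` is a stable inverse of `x`;
  -- likewise for `f ∘ₗ g`.
  refine of_inverses (g := (2 • LinearMap.id - g ∘ₗ f) ∘ₗ g)
    (g' := g ∘ₗ (2 • LinearMap.id - f ∘ₗ g)) ?_ ?_
  · rw [StablyEq]
    convert h.neg using 1
    ext x
    simp [two_smul]
    abel
  · rw [StablyEq]
    convert h'.neg using 1
    ext x
    simp [two_smul]
    abel

end IsStableIso

variable {K : Type*} [AddCommGroup K] [Module A K]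

/-- If a projective endomorphism has values in the kernel of `q`, then the endomorphism of the
kernel that it induces has projective square. -/
theorem isProjectiveMap_comp_self_of_ker {q : M →ₗ[A] X} {u : M →ₗ[A] M} (hu : IsProjectiveMap u)
    (hq : q ∘ₗ u = 0) {h : LinearMap.ker q →ₗ[A] LinearMap.ker q}
    (hh : (LinearMap.ker q).subtype ∘ₗ h = u ∘ₗ (LinearMap.ker q).subtype) :
    IsProjectiveMap (h ∘ₗ h) := by
  have hx (x) : (h x : M) = u x := LinearMap.congr_fun hh x
  -- Restricting the codomain of `u` may destroy projectivity, since the factorization need not land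
  -- in the kernel. In the square one copy of `u` keeps its full codomain `M`.
  have : h ∘ₗ h = (u.codRestrict (LinearMap.ker q) fun x => LinearMap.congr_fun hq x) ∘ₗ u ∘ₗ
      (LinearMap.ker q).subtype := by
    ext x
    rw [LinearMap.comp_apply, hx, hx]
    rfl
  rw [this]
  exact (hu.comp_right _).comp_left _

/-- A stable isomorphism compatible with an isomorphism of quotients restricts to a stable
isomorphism of kernels. -/
theorem IsStableIso.restrict_ker {q : M →ₗ[A] X} {q' : N →ₗ[A] Y} (hq : Function.Surjective q)
    {f : M →ₗ[A] N} (hf : IsStableIso f) {φ : X ≃ₗ[A] Y} (h : q' ∘ₗ f = φ ∘ₗ q)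
    {f₁ : LinearMap.ker q →ₗ[A] LinearMap.ker q'}
    (hf₁ : (LinearMap.ker q').subtype ∘ₗ f₁ = f ∘ₗ (LinearMap.ker q).subtype) :
    IsStableIso f₁ := by
  obtain ⟨g₀, h₁, h₂⟩ := hf
  -- The stable inverse covers `φ.symm` only up to a projective map; lifting that map along `q`
  -- makes the relation strict, so that the inverse also restricts to kernels.
  have h₃ : StablyEq ((φ.symm : Y →ₗ[A] X) ∘ₗ q') (q ∘ₗ g₀) := by
    have := ((h₂.comp_left q').comp_left (φ.symm : Y →ₗ[A] X)).symm
    have he : (φ.symm : Y →ₗ[A] X) ∘ₗ q' ∘ₗ f ∘ₗ g₀ = q ∘ₗ g₀ := by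
      rw [← LinearMap.comp_assoc g₀ f q', h]
      ext x
      simp
    rwa [he, LinearMap.comp_id] at this
  obtain ⟨g, hg, hgq⟩ := h₃.exists_lift hq
  replace h₁ := (hg.comp_right f).trans h₁
  replace h₂ := (hg.comp_left f).trans h₂
  have hx (x) : q' (f x) = φ (q x) := LinearMap.congr_fun h x
  have hy (y) : q (g y) = φ.symm (q' y) := LinearMap.congr_fun hgq y
  have hf₁x (x) : (f₁ x : N) = f x := LinearMap.congr_fun hf₁ x
  let g₁ : LinearMap.ker q' →ₗ[A] LinearMap.ker q := g.restrict fun y hy' => by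
    rw [LinearMap.mem_ker] at hy' ⊢
    rw [hy, hy', map_zero]
  have hg₁x (y) : (g₁ y : M) = g y := rfl
  refine IsStableIso.of_sq (g := g₁) ?_ ?_
  · refine isProjectiveMap_comp_self_of_ker (u := g ∘ₗ f - LinearMap.id) h₁ ?_ ?_
    · ext x
      simp [hx, hy]
    · ext x
      simp [hf₁x, hg₁x]
  · refine isProjectiveMap_comp_self_of_ker (u := f ∘ₗ g - LinearMap.id) h₂ ?_ ?_
    · ext x
      simp [hx, hy]
    · ext x
      simp [hf₁x, hg₁x]

/-- An isomorphism of kernels stably equal to the restriction of `f` extends to an isomorphism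
stably equal to `f`. -/
theorem exists_linearEquiv_extension (hinj : Module.Injective A A) {q : M →ₗ[A] X}
    {q' : N →ₗ[A] Y} (hq : Function.Surjective q) {f : M →ₗ[A] N} {φ : X ≃ₗ[A] Y}
    (h : q' ∘ₗ f = φ ∘ₗ q) {f₁ : LinearMap.ker q →ₗ[A] LinearMap.ker q'}
    (hf₁ : (LinearMap.ker q').subtype ∘ₗ f₁ = f ∘ₗ (LinearMap.ker q).subtype)
    (σ₁ : LinearMap.ker q ≃ₗ[A] LinearMap.ker q')
    (hσ₁ : StablyEq (σ₁ : LinearMap.ker q →ₗ[A] LinearMap.ker q') f₁) :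
    ∃ σ : M ≃ₗ[A] N, StablyEq (σ : M →ₗ[A] N) f ∧ (∀ x, q' (σ x) = φ (q x)) ∧
      ∀ x : LinearMap.ker q, σ x = σ₁ x := by
  -- Extend `σ₁ - f₁` to `p : M → ker q'`. Adding it to `f` does not change the map on quotients, so
  -- the five lemma argument gives bijectivity.
  obtain ⟨p, hp, hpe⟩ := IsProjectiveMap.exists_extension hinj hσ₁
    (LinearMap.ker q).injective_subtype
  let s : M →ₗ[A] N := f + (LinearMap.ker q').subtype ∘ₗ p
  have hs₁ (x : LinearMap.ker q) : s x = σ₁ x := by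
    have h1 : p x = σ₁ x - f₁ x := LinearMap.congr_fun hpe x
    have h2 : (f₁ x : N) = f x := LinearMap.congr_fun hf₁ x
    simp [s, h1, h2]
  have hsq (x) : q' (s x) = φ (q x) := by
    have : q' (f x) = φ (q x) := LinearMap.congr_fun h x
    simp [s, this]
  have hb : Function.Bijective s := by
    constructor
    · rw [← LinearMap.ker_eq_bot, Submodule.eq_bot_iff]
      intro x hx
      rw [LinearMap.mem_ker] at hx
      have hxq : q x = 0 := by simpa [hx] using (hsq x).symm
      have := hs₁ ⟨x, hxq⟩
      rw [hx] at this
      simpa using congrArg Subtype.val (σ₁.map_eq_zero_iff.1 (Subtype.ext this.symm))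
    · intro y
      obtain ⟨x, hx⟩ := hq (φ.symm (q' y))
      obtain ⟨z, hz⟩ := σ₁.surjective ⟨y - s x, by simp [hsq, hx]⟩
      refine ⟨x + z, ?_⟩
      rw [map_add, hs₁, hz]
      simp
  refine ⟨LinearEquiv.ofBijective s hb, ?_, hsq, hs₁⟩
  have : StablyEq s f := by simpa [StablyEq, s] using hp.comp_left (LinearMap.ker q').subtype
  exact this

end StablyEq

/-! ### Stable isomorphisms within `add S` are represented by isomorphisms -/

section Matrices

universe u

variable (k : Type*) {A : Type u} [Field k] [Ring A] [Algebra k A] {ι : Type*}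
  {S : ι → Type*} [∀ i, AddCommGroup (S i)] [∀ i, Module k (S i)] [∀ i, Module A (S i)]
  [∀ i, IsScalarTower k A (S i)] {m n l : ℕ} {a : Fin m → ι} {b : Fin n → ι} {c : Fin l → ι}

/-- The maps between sums of members of `S` whose components are scalar. -/
def IsScalarMatrix (f : ((j : Fin m) → S (a j)) →ₗ[A] ((j : Fin n) → S (b j))) : Prop :=
  ∀ i j, IsScalarMap k (LinearMap.proj j ∘ₗ f ∘ₗ LinearMap.single A (fun j => S (a j)) i)

variable {k}

namespace IsScalarMatrix

theorem id : IsScalarMatrix k (LinearMap.id : ((j : Fin m) → S (a j)) →ₗ[A] _) := by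
  intro i j
  by_cases hij : i = j
  · subst hij
    have := IsScalarMap.smul_id (A := A) (S := S) (1 : k) (a i)
    convert this using 1
    ext x
    simp
  · convert IsScalarMap.zero (k := k) (A := A) (S := S) (a i) (a j) using 1
    ext x
    simp [Pi.single_eq_of_ne (Ne.symm hij)]

theorem sub {f g : ((j : Fin m) → S (a j)) →ₗ[A] ((j : Fin n) → S (b j))}
    (hf : IsScalarMatrix k f) (hg : IsScalarMatrix k g) : IsScalarMatrix k (f - g) := by
  intro i j
  rw [LinearMap.sub_comp, LinearMap.comp_sub, sub_eq_add_neg]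
  exact (hf i j).add (hg i j).neg

theorem comp {g : ((j : Fin n) → S (b j)) →ₗ[A] ((j : Fin l) → S (c j))}
    {f : ((j : Fin m) → S (a j)) →ₗ[A] ((j : Fin n) → S (b j))}
    (hg : IsScalarMatrix k g) (hf : IsScalarMatrix k f) : IsScalarMatrix k (g ∘ₗ f) := by
  intro i j
  have : LinearMap.proj j ∘ₗ (g ∘ₗ f) ∘ₗ LinearMap.single A (fun j => S (a j)) i =
      ∑ t, (LinearMap.proj j ∘ₗ g ∘ₗ LinearMap.single A (fun j => S (b j)) t) ∘ₗ
        (LinearMap.proj (φ := fun j => S (b j)) t ∘ₗ f ∘ₗ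
          LinearMap.single A (fun j => S (a j)) i) := by
    ext x
    simp only [LinearMap.comp_apply, LinearMap.sum_apply]
    rw [← map_sum, ← map_sum]
    congr 2
    ext t
    simp
  rw [this]
  exact IsScalarMap.sum _ fun t _ => (hg t j).comp (hf i t)

end IsScalarMatrix

namespace IsStablyOrthogonal

variable (hS : IsStablyOrthogonal k A S)
include hS

theorem exists_isScalarMatrix (f : ((j : Fin m) → S (a j)) →ₗ[A] ((j : Fin n) → S (b j))) :
    ∃ f₀ : ((j : Fin m) → S (a j)) →ₗ[A] ((j : Fin n) → S (b j)),
      IsScalarMatrix k f₀ ∧ StablyEq f f₀ := by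
  choose g hg hgp using fun i j => hS.exists_isScalarMap
    (LinearMap.proj (φ := fun j => S (b j)) j ∘ₗ f ∘ₗ LinearMap.single A (fun j => S (a j)) i)
  let f₀ : ((j : Fin m) → S (a j)) →ₗ[A] ((j : Fin n) → S (b j)) :=
    LinearMap.pi fun j => ∑ i, g i j ∘ₗ LinearMap.proj i
  have h₀ (i j) : LinearMap.proj j ∘ₗ f₀ ∘ₗ LinearMap.single A (fun j => S (a j)) i = g i j := by
    ext x
    simp only [f₀, LinearMap.comp_apply, LinearMap.proj_apply, LinearMap.pi_apply,
      LinearMap.sum_apply, LinearMap.single_apply]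
    rw [Finset.sum_eq_single i (fun t _ ht => by simp [Pi.single_eq_of_ne ht]) (by simp)]
    simp
  refine ⟨f₀, fun i j => by rw [h₀]; exact hg i j, IsProjectiveMap.pi fun j => ?_⟩
  have : LinearMap.proj j ∘ₗ (f - f₀) = ∑ i, (LinearMap.proj j ∘ₗ f ∘ₗ
      LinearMap.single A (fun j => S (a j)) i - g i j) ∘ₗ LinearMap.proj i := by
    refine LinearMap.pi_ext fun t x => ?_
    simp only [LinearMap.sum_apply, LinearMap.comp_apply, LinearMap.proj_apply]
    rw [Finset.sum_eq_single t (fun s _ hs => by simp [Pi.single_eq_of_ne hs]) (by simp)]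
    have := LinearMap.congr_fun (h₀ t j) x
    simp only [LinearMap.comp_apply, LinearMap.proj_apply, LinearMap.single_apply] at this
    simp [this]
  rw [this]
  exact IsProjectiveMap.sum _ fun i _ =>
    (hgp i j).comp_right (LinearMap.proj (φ := fun j => S (a j)) i)

theorem eq_of_stablyEq {f g : ((j : Fin m) → S (a j)) →ₗ[A] ((j : Fin n) → S (b j))}
    (hf : IsScalarMatrix k f) (hg : IsScalarMatrix k g) (h : StablyEq f g) : f = g := by
  refine LinearMap.pi_ext fun i x => funext fun j => ?_
  have := hS.eq_zero_of_isScalarMap (hf.sub hg i j) ((IsProjectiveMap.comp_right h _).comp_left _)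
  have := LinearMap.congr_fun this x
  simpa [sub_eq_zero] using this

/-- A stable isomorphism between sums of members of `S` is stably equal to an isomorphism. -/
theorem exists_linearEquiv_of_isStableIso
    {f : ((j : Fin m) → S (a j)) →ₗ[A] ((j : Fin n) → S (b j))} (hf : IsStableIso f) :
    ∃ e : ((j : Fin m) → S (a j)) ≃ₗ[A] ((j : Fin n) → S (b j)),
      StablyEq (e : _ →ₗ[A] _) f := by
  obtain ⟨g, h₁, h₂⟩ := hf
  obtain ⟨f₀, hf₀, hf⟩ := hS.exists_isScalarMatrix f
  obtain ⟨g₀, hg₀, hg⟩ := hS.exists_isScalarMatrix g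
  -- Scalar matrices are closed under composition and determined by their stable class, so stable
  -- inverses become strict inverses.
  refine ⟨LinearEquiv.ofLinearMap f₀ g₀ ?_ ?_, ?_⟩
  · exact hS.eq_of_stablyEq (hf₀.comp hg₀) .id ((hf.comp hg).symm.trans h₂)
  · exact hS.eq_of_stablyEq (hg₀.comp hf₀) .id ((hg.comp hf).symm.trans h₁)
  · exact hf.symm

end IsStablyOrthogonal

end Matrices

/-! ### Comparison of radical filtrations -/

section Universal

universe u v w v'

variable {k : Type*} {A : Type u} [Field k] [Ring A] [Algebra k A] {ι : Type*}
  {S : ι → Type*} [∀ i, AddCommGroup (S i)] [∀ i, Module k (S i)] [∀ i, Module A (S i)]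
  [∀ i, IsScalarTower k A (S i)] {M : Type v} [AddCommGroup M] [Module A M]
  {M' : Type v'} [AddCommGroup M'] [Module A M'] {n n' : ℕ} {c : Fin n → ι} {c' : Fin n' → ι}

namespace IsStablyUniversal

theorem exists_factor_pi {X : Type w} [AddCommGroup X] [Module A X] {q : M →ₗ[A] X}
    (hq : IsStablyUniversal S q) (h : M →ₗ[A] ((j : Fin n) → S (c j))) :
    ∃ g : X →ₗ[A] ((j : Fin n) → S (c j)), StablyEq h (g ∘ₗ q) := by
  choose g hg using fun j => hq.exists_factor (c j)
    (LinearMap.proj (φ := fun j => S (c j)) j ∘ₗ h)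
  exact ⟨LinearMap.pi g, IsProjectiveMap.pi (Z := fun j => S (c j)) hg⟩

theorem stablyEq_of_comp {X : Type w} [AddCommGroup X] [Module A X] {q : M →ₗ[A] X}
    (hq : IsStablyUniversal S q) {f g : X →ₗ[A] ((j : Fin n) → S (c j))}
    (h : StablyEq (f ∘ₗ q) (g ∘ₗ q)) : StablyEq f g :=
  IsProjectiveMap.pi (Z := fun j => S (c j)) fun j => hq.isProjectiveMap (c j) _ (by
    rw [StablyEq, ← LinearMap.sub_comp] at h
    exact h.comp_left (LinearMap.proj (φ := fun j => S (c j)) j))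

/-- The usual uniqueness of universal objects, in the stable category: `q' ∘ₗ f` and `q ∘ₗ g` induce
mutually inverse stable maps of the targets. -/
theorem exists_linearEquiv (hS : IsStablyOrthogonal k A S)
    {q : M →ₗ[A] ((j : Fin n) → S (c j))} {q' : M' →ₗ[A] ((j : Fin n') → S (c' j))}
    (hq : IsStablyUniversal S q) (hq' : IsStablyUniversal S q') {f : M →ₗ[A] M'}
    (hf : IsStableIso f) :
    ∃ φ : ((j : Fin n) → S (c j)) ≃ₗ[A] ((j : Fin n') → S (c' j)),
      StablyEq ((φ : _ →ₗ[A] _) ∘ₗ q) (q' ∘ₗ f) := by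
  obtain ⟨g, h₁, h₂⟩ := hf
  obtain ⟨φ, hφ⟩ := hq.exists_factor_pi (q' ∘ₗ f)
  obtain ⟨ψ, hψ⟩ := hq'.exists_factor_pi (q ∘ₗ g)
  have h₃ : StablyEq (ψ ∘ₗ φ) LinearMap.id := hq.stablyEq_of_comp
    (((hφ.comp_left ψ).symm.trans (hψ.comp_right f).symm).trans (h₁.comp_left q))
  have h₄ : StablyEq (φ ∘ₗ ψ) LinearMap.id := hq'.stablyEq_of_comp
    (((hψ.comp_left φ).symm.trans (hφ.comp_right g).symm).trans (h₂.comp_left q'))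
  obtain ⟨e, he⟩ := hS.exists_linearEquiv_of_isStableIso ⟨ψ, h₃, h₄⟩
  exact ⟨e, (he.comp_right q).trans hφ.symm⟩

end IsStablyUniversal

theorem HasNoProjectiveSubmodule.subsingleton (hM : HasNoProjectiveSubmodule A S M)
    (h : IsProjectiveMap (LinearMap.id : M →ₗ[A] M)) : Subsingleton M := by
  have := h.module_projective
  have h1 := hM ⊤ 0 (Module.Projective.of_equiv Submodule.topEquiv.symm)
    (inferInstanceAs (Subsingleton (M ⧸ (⊤ : Submodule A M))))
  exact (Submodule.subsingleton_iff A).1 (subsingleton_of_bot_eq_top h1.symm)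

theorem IsStableIso.subsingleton_left [Subsingleton M'] {f : M →ₗ[A] M'} (hf : IsStableIso f)
    (hM : HasNoProjectiveSubmodule A S M) : Subsingleton M := by
  obtain ⟨g, hg, -⟩ := hf
  refine hM.subsingleton ?_
  have hf0 : f = 0 := by
    ext
    exact Subsingleton.elim _ _
  rw [StablyEq, hf0, LinearMap.comp_zero, zero_sub] at hg
  simpa using hg.neg

theorem IsStableIso.subsingleton_right [Subsingleton M] {f : M →ₗ[A] M'} (hf : IsStableIso f)
    (hM : HasNoProjectiveSubmodule A S M') : Subsingleton M' := by
  obtain ⟨g, h₁, h₂⟩ := hf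
  exact IsStableIso.subsingleton_left ⟨f, h₂, h₁⟩ hM

theorem succ_le_one_of_forall_lt {α : Type*} [Preorder α] {F : ℕ → α} {r : ℕ}
    (h : ∀ i < r + 1, F (i + 1) < F i) {i : ℕ} (hi : i ≤ r) : F (i + 1) ≤ F 1 := by
  induction i with
  | zero => exact le_rfl
  | succ i ih => exact (h (i + 1) (by omega)).le.trans (ih (by omega))

/-- A stable isomorphism between modules with no projective remainder can be changed by a
projective map into an isomorphism that respects given `S`-radical filtrations. -/
theorem exists_linearEquiv_of_radical_chains (hS : IsStablyOrthogonal k A S)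
    (hinj : Module.Injective A A) {r r' : ℕ} {F : ℕ → Submodule A M} {F' : ℕ → Submodule A M'}
    (hr : F r = ⊥) (hr' : F' r' = ⊥)
    (hF : ∀ i < r, F (i + 1) < F i ∧ IsMinimalFiltrable A S ((F (i + 1)).submoduleOf (F i)))
    (hF' : ∀ i < r', F' (i + 1) < F' i ∧
      IsMinimalFiltrable A S ((F' (i + 1)).submoduleOf (F' i)))
    (h : HasNoProjectiveSubmodule A S (F 0)) (h' : HasNoProjectiveSubmodule A S (F' 0))
    {f : F 0 →ₗ[A] F' 0} (hf : IsStableIso f) :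
    r = r' ∧ ∃ σ : F 0 ≃ₗ[A] F' 0, StablyEq (σ : F 0 →ₗ[A] F' 0) f ∧
      ∀ i ≤ r, ∀ x : F 0, (x : M) ∈ F i ↔ (σ x : M') ∈ F' i := by
  -- The compared modules are `F 0` and `F' 0` inside fixed ambient modules, so passing to the
  -- kernels is just a shift of the index.
  induction r generalizing r' F F' with
  | zero =>
    have : Subsingleton (F 0) := (Submodule.subsingleton_iff_eq_bot).2 hr
    have := hf.subsingleton_right h'
    rcases r' with _ | r'
    · refine ⟨rfl, 0, ?_, ?_⟩
      · exact .of_subsingleton_left _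
      · intro i hi x
        obtain rfl : i = 0 := by omega
        simp
    · refine absurd (hF' 0 (by omega)).1 ?_
      rw [(Submodule.subsingleton_iff_eq_bot).1 this]
      exact not_lt_bot
  | succ r ih =>
    rcases r' with _ | r'
    · have : Subsingleton (F' 0) := (Submodule.subsingleton_iff_eq_bot).2 hr'
      have := hf.subsingleton_left h
      refine absurd (hF 0 (by omega)).1 ?_
      rw [(Submodule.subsingleton_iff_eq_bot).1 this]
      exact not_lt_bot
    obtain ⟨hlt, hmin⟩ := hF 0 (by omega)
    obtain ⟨hlt', hmin'⟩ := hF' 0 (by omega)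
    rw [zero_add] at hlt hmin hlt' hmin'
    obtain ⟨n, c, q, hq, hk⟩ := hmin.prop.2.exists_surjective
    obtain ⟨n', c', q', hq', hk'⟩ := hmin'.prop.2.exists_surjective
    obtain ⟨φ, hφ⟩ := IsStablyUniversal.exists_linearEquiv hS
      (hmin.isStablyUniversal hS hinj h hq hk) (hmin'.isStablyUniversal hS hinj h' hq' hk') hf
    -- `g` is stably equal to `f` and covers `φ` strictly, hence maps `ker q` to `ker q'`.
    obtain ⟨g, hgf, hg⟩ := hφ.exists_lift hq'
    let e : LinearMap.ker q ≃ₗ[A] F 1 :=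
      (LinearEquiv.ofEq _ _ hk).trans (Submodule.submoduleOfEquivOfLe hlt.le)
    let e' : LinearMap.ker q' ≃ₗ[A] F' 1 :=
      (LinearEquiv.ofEq _ _ hk').trans (Submodule.submoduleOfEquivOfLe hlt'.le)
    let g₁ : LinearMap.ker q →ₗ[A] LinearMap.ker q' := g.restrict fun x hx => by
      rw [LinearMap.mem_ker] at hx ⊢
      rw [← LinearMap.comp_apply, hg, LinearMap.comp_apply, hx, map_zero]
    have hg₁ : (LinearMap.ker q').subtype ∘ₗ g₁ = g ∘ₗ (LinearMap.ker q).subtype := rfl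
    have hiso : IsStableIso g₁ := (hf.congr hgf).restrict_ker hq hg hg₁
    have hnp : HasNoProjectiveSubmodule A S (F 1) :=
      (h.submodule (N := LinearMap.ker q) ((isFiltered_pi n c).of_equiv
        (q.quotKerEquivOfSurjective hq).symm)).of_equiv e
    have hnp' : HasNoProjectiveSubmodule A S (F' 1) :=
      (h'.submodule (N := LinearMap.ker q') ((isFiltered_pi n' c').of_equiv
        (q'.quotKerEquivOfSurjective hq').symm)).of_equiv e'
    obtain ⟨rfl, τ, hτ, hτF⟩ := ih (F := fun i => F (i + 1)) (F' := fun i => F' (i + 1))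
      hr hr' (fun i hi => hF (i + 1) (by omega)) (fun i hi => hF' (i + 1) (by omega)) hnp hnp'
      (e'.isStableIso.comp (hiso.comp e.symm.isStableIso))
    obtain ⟨σ, hσ, hσq, hσ₁⟩ := exists_linearEquiv_extension hinj hq hg hg₁
      ((e.trans τ).trans e'.symm) (by
        convert (hτ.comp_right (e : LinearMap.ker q →ₗ[A] F 1)).comp_left
          (e'.symm : F' 1 →ₗ[A] LinearMap.ker q') using 1
        all_goals
          ext x
          simp)
    refine ⟨rfl, σ, hσ.trans hgf, fun i hi x => ?_⟩
    rcases i with _ | i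
    · simp
    have hmem (x : F 0) : (x : M) ∈ F 1 ↔ q x = 0 := by
      rw [← LinearMap.mem_ker, hk]
      rfl
    have hmem' (x : F' 0) : (x : M') ∈ F' 1 ↔ q' x = 0 := by
      rw [← LinearMap.mem_ker, hk']
      rfl
    -- On `ker q` the map `σ` is `τ`, and the induction applies. Off `ker q`, since `σ` covers the
    -- isomorphism `φ`, neither `x` nor `σ x` lies in the first term, let alone a deeper one.
    by_cases hx : q x = 0
    · have hx₁ : (σ x : M') = τ (e ⟨x, hx⟩) := by
        rw [hσ₁ ⟨x, hx⟩]
        exact congrArg Subtype.val (e'.apply_symm_apply (τ (e ⟨x, hx⟩)))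
      rw [hx₁]
      exact hτF i (by omega) (e ⟨x, hx⟩)
    · have hle := succ_le_one_of_forall_lt (fun i hi => (hF i hi).1) (show i ≤ r by omega)
      have hle' := succ_le_one_of_forall_lt (fun i hi => (hF' i hi).1) (show i ≤ r by omega)
      refine iff_of_false (fun hm => hx ((hmem x).1 (hle hm))) fun hm => hx ?_
      have := (hmem' _).1 (hle' hm)
      rwa [hσq, LinearEquiv.map_eq_zero_iff] at this

end Universal

end StableFiltration

open StableFiltration in
theorem mainTheorem9 {k A : Type*} [Field k] [Ring A] [Algebra k A] [Module.Finite k A]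
    (hsplit : IsSplit k A) (hinj : Module.Injective A A) (hproj : NoProjectiveSimple A)
    {ι : Type*} [Finite ι] (S : ι → Type*) [∀ i, AddCommGroup (S i)] [∀ i, Module k (S i)]
    [∀ i, Module A (S i)] [∀ i, IsScalarTower k A (S i)] (hS : IsStablyOrthogonal k A S)
    {M : Type*} [AddCommGroup M] [Module A M]
    (hM : IsFiltrable A S M) (hM' : HasNoProjectiveRemainder A S M)
    (r r' : ℕ) (F F' : ℕ → Submodule A M)
    (hF : IsRadicalFiltration A S r F) (hF' : IsRadicalFiltration A S r' F') :
    r = r' ∧ ∃ σ : M ≃ₗ[A] M,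
      IsProjectiveMap ((σ : M →ₗ[A] M) - LinearMap.id) ∧
        ∀ i ≤ r, (F' i).map (σ : M →ₗ[A] M) = F i := by
  obtain ⟨h0, hr, hF⟩ := hF
  obtain ⟨h0', hr', hF'⟩ := hF'
  have := hS.finite
  obtain ⟨n, hn⟩ := hM.exists_isFiltered
  have := hn.finite
  have : IsNoetherianRing A := isNoetherian_of_tower k inferInstance
  have hnp := hM'.hasNoProjectiveSubmodule hinj
  let t : F 0 ≃ₗ[A] M := LinearEquiv.ofTop _ h0
  let t' : F' 0 ≃ₗ[A] M := LinearEquiv.ofTop _ h0'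
  -- The stable isomorphism is the identity of `M`, read from `F' 0 = ⊤` to `F 0 = ⊤`; the primed
  -- filtration is the source because `σ` must carry it to the other.
  obtain ⟨rfl, σ, hσ, hσF⟩ := exists_linearEquiv_of_radical_chains hS hinj hr' hr hF' hF
    (hnp.of_equiv t'.symm) (hnp.of_equiv t.symm) (t'.trans t.symm).isStableIso
  refine ⟨rfl, (t'.symm.trans σ).trans t, ?_, fun i hi => ?_⟩
  · have := (hσ.comp_left (t : _ →ₗ[A] M)).comp_right (t'.symm : M →ₗ[A] _)
    rw [StablyEq] at this
    convert this using 1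
    ext x
    simp
  · ext y
    rw [Submodule.mem_map]
    constructor
    · rintro ⟨x, hx, rfl⟩
      exact (hσF i hi (t'.symm x)).1 hx
    · intro hy
      refine ⟨t' (σ.symm (t.symm y)), ?_, by simp⟩
      refine (hσF i hi (σ.symm (t.symm y))).2 ?_
      rw [σ.apply_symm_apply]
      exact hy
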